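/- Let $n>1$ be an odd integer that is not divisible by $3$. For a two-element set $\{a,b\}\subseteq\mathbb{Z}_n\setminus\{0\}$ that generates the group $\mathbb{Z}_n$, let $\Gamma(\mathbb{Z}_n,\{a,b\})$ be the directed circulant graph with vertex set $\mathbb{Z}_n$ and an arc from $j$ to $i$ if and only if $i-j\in\{a,b\}$. For a digraph $D$ and $p\in[0,1]$, let $\mathrm{scnRel}(D,p)$ be its strongly connected node reliability: the probability that the operational vertices induce a strongly connected (in particular nonempty) subdigraph of $D$, when each vertex is operational independently with probability $p$. Let $G=\Gamma(\mathbb{Z}_n,\{1,2\cdot 3^{-1}\})$, where $3^{-1}$ is the inverse of $3$ in $\mathbb{Z}_n$. Then $G$ is optimally-greatest for values of $p$ near one among the directed circulant graphs of the form $\Gamma(\mathbb{Z}_n,\{a,b\})$: the set $\{1,2\cdot 3^{-1}\}$ is a two-element generating set of $\mathbb{Z}_n$ that does not contain $0$, and there is an $\varepsilon>0$ such that $$\mathrm{scnRel}(G,p)\ \ge\ \mathrm{scnRel}(\Gamma(\mathbb{Z}_n,\{a,b\}),p)$$ for every two-element generating set $\{a,b\}\subseteq\mathbb{Z}_n\setminus\{0\}$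 of $\mathbb{Z}_n$ and every $p\in[0,1]\cap(1-\varepsilon,1+\varepsilon)$. -/

import Mathlib

namespace CirculantReliability

/-- The subdigraph of `G` induced by the vertex set `S`. -/
def inducedSubdigraph {V : Type*} (G : Digraph V) (S : Set V) : Digraph S where
  Adj u v := G.Adj u v

/-- A digraph is strongly connected if it has at least one vertex and every vertex can be reached
from every vertex by a directed walk. The null digraph does not count as strongly connected. -/
def IsStronglyConnected {V : Type*} (G : Digraph V) : Prop :=
  Nonempty V ∧ ∀ u v : V, Relation.ReflTransGen G.Adj u v

open Classical in
/-- The strongly connected node reliability of `G` at `p`: the probability that the set `S` of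
operational vertices induces a strongly connected subdigraph, when the vertices operate
independently with probability `p`. -/
noncomputable def reliability {V : Type*} [Fintype V] (G : Digraph V) (p : ℝ) : ℝ :=
  ∑ S : Finset V,
    if IsStronglyConnected (inducedSubdigraph G (S : Set V)) then
      p ^ S.card * (1 - p) ^ (Fintype.card V - S.card)
    else 0

/-- `G` is an optimally-greatest member of the family `F` for values of `p` near `p₀`. -/
def IsOptimallyGreatestNear {V : Type*} [Fintype V] (F : Set (Digraph V)) (G : Digraph V)
    (p₀ : ℝ) : Prop :=
  G ∈ F ∧ ∃ ε : ℝ, 0 < ε ∧ ∀ H ∈ F, ∀ p ∈ Set.Icc (0 : ℝ) 1 ∩ Set.Ioo (p₀ - ε) (p₀ + ε),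
    reliability H p ≤ reliability G p

/-- A generating set of an additive group: it omits the identity and generates the group. -/
def IsGeneratingSet {A : Type*} [AddGroup A] (S : Set A) : Prop :=
  (0 : A) ∉ S ∧ AddSubgroup.closure S = ⊤

/-- The digraph `Γ(ℤ_n, S)`, with an arc from `j` to `i` iff `i - j ∈ S`. -/
def circulant (n : ℕ) (S : Set (ZMod n)) : Digraph (ZMod n) where
  Adj j i := i - j ∈ S

/-- The directed circulant graphs of the form `Γ(ℤ_n, {a, b})`, where `{a, b}` is a generating set
with two distinct elements. -/
def twoCirculants (n : ℕ) : Set (Digraph (ZMod n)) :=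
  {H | ∃ a b : ZMod n, a ≠ b ∧ IsGeneratingSet {a, b} ∧ H = circulant n {a, b}}

end CirculantReliability

/-! With `x = (1 - p) / p`, the reliability is `p ^ n` times a polynomial in `x` counting, by size,
the failing sets that leave the graph strongly connected. These polynomials are compared for small
`x`. Multiplication by a unit replaces the candidate by the circulant with steps 2 and 3.

Let `F` survive in `Γ(ℤ_n, {a, b})` with at least two vertices left. If `w` and `w + (b - a)` fail,
then `w - a` has lost both out-neighbours and `w + b` both in-neighbours, so these fail too
(`Survives.pairClosed`). Hence `F` either contains no two elements differing by `b - a`, or contains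
a translate of `{-a, 0, b - a, b}`. For steps 2 and 3 every 1-step-free set does survive
(`survives_two_three_of_stepFree`), and for odd `n` no step has a larger step-free generating
function than 1 (`stepFreeSum_le_stepFreeSum_one`), so the main terms compare correctly.

The surviving sets that are not step-free decide the rest. Steps 2 and 3 have at least `n` of size 4
and `n(n - 8)` of size 5 (`stepFreeSum_add_quadruples_le`). Outside the degenerate cases a
competitor has at most `n` and `n(n - 9)`, and the surplus in `x ^ 5` absorbs all higher terms once
`2 ^ n * x ≤ 1`. In the degenerate cases, `a = 2b` or `b = 2a` adds only the complements of single
vertices, while `b = -a` already loses at `x ^ 2`. -/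

namespace CirculantReliability
open Finset

/-! ### Step-free sets and transfer matrices. -/

/-- No two elements of `F` differ by `d`. -/
def StepFree {A : Type*} [AddCommGroup A] (d : A) (F : Finset A) : Prop :=
  ∀ w, w ∈ F → w + d ∉ F

/-- The transfer matrix of the hard-core model with activity `x`. -/
def transfer (x : ℝ) : Matrix Bool Bool ℝ :=
  Matrix.of fun u v => if v then (if u then 0 else x) else 1

open Classical in
/-- The generating function of the `d`-step-free sets. -/
noncomputable def stepFreeSum {A : Type*} [AddCommGroup A] [Fintype A] (d : A) (x : ℝ) : ℝ :=
  ∑ F : Finset A, if StepFree d F then x ^ F.card else 0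

theorem stepFreeSum_eq_sum_prod {A : Type*} [AddCommGroup A] [Fintype A] [DecidableEq A] (d : A)
    (x : ℝ) : stepFreeSum d x = ∑ f : A → Bool, ∏ w, transfer x (f w) (f (w + d)) := by
  classical
  unfold stepFreeSum
  refine Fintype.sum_bijective (fun (F : Finset A) (a : A) => decide (a ∈ F)) ⟨?_, ?_⟩ _ _ ?_
  · intro F F' h
    ext a
    simpa using congrFun h a
  · intro f
    exact ⟨univ.filter fun a => f a = true, by ext a; simp⟩
  · intro F
    by_cases hF : StepFree d F
    · rw [if_pos hF]
      have h1 : ∀ w, transfer x (decide (w ∈ F)) (decide (w + d ∈ F)) =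
          if w + d ∈ F then x else 1 := by
        intro w
        by_cases h : w + d ∈ F
        · have : w ∉ F := fun hw => hF w hw h
          simp [transfer, h, this]
        · simp [transfer, h]
      rw [Fintype.prod_congr _ _ h1,
        Fintype.prod_equiv (Equiv.addRight d) (fun w => if w + d ∈ F then x else 1)
          (fun w => if w ∈ F then x else 1) (fun w => rfl)]
      simp
    · rw [if_neg hF]
      unfold StepFree at hF
      push Not at hF
      obtain ⟨w, hw, hwd⟩ := hF
      exact (Finset.prod_eq_zero (mem_univ w) (by simp [transfer, hw, hwd])).symm

/-- An arbitrary weight `φ` on the endpoints lets the induction run: the first edge is absorbed into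
`φ`. The choice `φ u v = M v u` later closes the path into a cycle. -/
theorem sum_path_prod {ι : Type*} [Fintype ι] [DecidableEq ι] (M : Matrix ι ι ℝ) (k : ℕ)
    (φ : ι → ι → ℝ) :
    ∑ f : Fin (k + 1) → ι, φ (f 0) (f (Fin.last k)) * ∏ i : Fin k, M (f i.castSucc) (f i.succ) =
      ∑ u, ∑ v, φ u v * (M ^ k) u v := by
  induction k generalizing φ with
  | zero =>
    rw [Fintype.sum_equiv (Equiv.funUnique (Fin 1) ι) _ (fun u => φ u u)]
    · simp [Matrix.one_apply]
    · intro f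
      simp
  | succ k ih =>
    rw [← Fintype.sum_equiv (Fin.consEquiv fun _ => ι) (fun p : ι × (Fin (k + 1) → ι) =>
      (φ p.1 (p.2 (Fin.last k)) * M p.1 (p.2 0)) *
        ∏ i : Fin k, M (p.2 i.castSucc) (p.2 i.succ)) _ ?_]
    · rw [Fintype.sum_prod_type]
      refine Fintype.sum_congr _ _ fun u => ?_
      rw [ih fun v w => φ u w * M u v, Finset.sum_comm]
      refine Fintype.sum_congr _ _ fun w => ?_
      rw [pow_succ', Matrix.mul_apply, Finset.mul_sum]
      exact Fintype.sum_congr _ _ fun v => by ring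
    · rintro ⟨u, f⟩
      rw [Fin.prod_univ_succ]
      simp [Fin.consEquiv, ← Fin.succ_last, mul_assoc]

theorem sum_cycle_prod {ι : Type*} [Fintype ι] [DecidableEq ι] (M : Matrix ι ι ℝ) (k : ℕ)
    [NeZero k] :
    ∑ f : ZMod k → ι, ∏ i, M (f i) (f (i + 1)) = (M ^ k).trace := by
  obtain ⟨m, rfl⟩ := Nat.exists_eq_succ_of_ne_zero (NeZero.ne k)
  change ∑ f : Fin (m + 1) → ι, ∏ i, M (f i) (f (i + 1)) = _
  have h : ∀ f : Fin (m + 1) → ι, ∏ i, M (f i) (f (i + 1)) =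
      M (f (Fin.last m)) (f 0) * ∏ i : Fin m, M (f i.castSucc) (f i.succ) := by
    intro f
    rw [Fin.prod_univ_castSucc, mul_comm]
    simp
  rw [Fintype.sum_congr _ _ h, sum_path_prod M m fun u v => M v u, Finset.sum_comm,
    Matrix.trace]
  refine Fintype.sum_congr _ _ fun v => ?_
  rw [Nat.succ_eq_add_one, pow_succ', Matrix.diag_apply, Matrix.mul_apply]

theorem stepFreeSum_one_zmod (k : ℕ) [NeZero k] (x : ℝ) :
    stepFreeSum (1 : ZMod k) x = (transfer x ^ k).trace := by
  rw [stepFreeSum_eq_sum_prod, sum_cycle_prod]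

/-- Translation by `d` splits the group into the cosets of `⟨d⟩`, each a cycle of length `addOrderOf
d`. The cycles do not interact, so the sum factors. -/
theorem stepFreeSum_eq_trace_pow {A : Type*} [AddCommGroup A] [Fintype A] [DecidableEq A] (d : A)
    (x : ℝ) :
    stepFreeSum d x = (transfer x ^ addOrderOf d).trace ^
      Nat.card (A ⧸ AddSubgroup.zmultiples d) := by
  classical
  have : NeZero (addOrderOf d) := ⟨(addOrderOf_pos d).ne'⟩
  set H := AddSubgroup.zmultiples d with hH
  let g : H := ⟨d, AddSubgroup.mem_zmultiples d⟩
  have hg : ∀ h : H, h ∈ AddSubgroup.zmultiples g := by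
    rintro ⟨h, k, rfl⟩
    exact ⟨k, by ext; simp [g]⟩
  let e₁ : ZMod (addOrderOf d) ≃+ H := zmodAddEquivOfGenerator hg (Nat.card_zmultiples d)
  have he₁ : e₁ 1 = g := zmodAddEquivOfGenerator_apply_one hg (Nat.card_zmultiples d)
  have hmk : ∀ (q : A ⧸ H) (j : ZMod (addOrderOf d)),
      ((q.out + (e₁ j : A) : A) : A ⧸ H) = q := by
    intro q j
    rw [QuotientAddGroup.mk_add_of_mem _ (e₁ j).2, QuotientAddGroup.out_eq']
  -- In the coordinates (coset, multiple of `d` added to its representative), translation by `d` is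
  -- `j ↦ j + 1`.
  let E : (A ⧸ H) × ZMod (addOrderOf d) ≃ A := Equiv.ofBijective
    (fun p => p.1.out + (e₁ p.2 : A)) (by
      constructor
      · rintro ⟨q, j⟩ ⟨q', j'⟩ h
        obtain rfl : q = q' := by rw [← hmk q j, ← hmk q' j']; exact congrArg _ h
        simpa using h
      · intro a
        have : -(a : A ⧸ H).out + a ∈ H := QuotientAddGroup.eq.mp (QuotientAddGroup.out_eq' _)
        exact ⟨((a : A ⧸ H), e₁.symm ⟨_, this⟩), by simp⟩)
  have hE : ∀ q j, E (q, j + 1) = E (q, j) + d := by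
    intro q j
    change q.out + (e₁ (j + 1) : A) = q.out + (e₁ j : A) + d
    rw [map_add, he₁, AddSubgroup.coe_add, add_assoc]
  rw [stepFreeSum_eq_sum_prod,
    ← Fintype.sum_equiv ((Equiv.curry _ _ Bool).symm.trans (E.arrowCongr (Equiv.refl Bool)))
      (fun f : A ⧸ H → ZMod (addOrderOf d) → Bool => ∏ q, ∏ j, transfer x (f q j) (f q (j + 1))) _
      ?_]
  · rw [← sum_cycle_prod, Nat.card_eq_fintype_card, ← Finset.card_univ, ← Finset.prod_const,
      Finset.prod_univ_sum]
    simp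
  · intro f
    rw [← Fintype.prod_prod_type', ← Fintype.prod_equiv E _ _ fun _ => rfl]
    refine Fintype.prod_congr _ _ fun ⟨q, j⟩ => ?_
    rw [← hE]
    simp [Equiv.arrowCongr, Equiv.curry, Function.uncurry]

theorem pow_apply_nonneg {ι : Type*} [Fintype ι] [DecidableEq ι] {M : Matrix ι ι ℝ}
    (hM : ∀ i j, 0 ≤ M i j) (k : ℕ) (i j : ι) : 0 ≤ (M ^ k) i j := by
  induction k generalizing j with
  | zero =>
    rw [pow_zero, Matrix.one_apply]
    split <;> norm_num
  | succ k ih =>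
    rw [pow_succ, Matrix.mul_apply]
    exact Finset.sum_nonneg fun l _ => mul_nonneg (ih l) (hM l j)

/-- Cayley-Hamilton gives `tr N^(k+2) = tr N * tr N^(k+1) - det N * tr N^k`, and the last term only
helps when `det N ≤ 0`. -/
theorem trace_pow_le_trace_pow {N : Matrix Bool Bool ℝ} (hN : ∀ i j, 0 ≤ N i j)
    (hdet : N.det ≤ 0) (k : ℕ) : N.trace ^ (k + 1) ≤ (N ^ (k + 1)).trace := by
  have htr : ∀ m, 0 ≤ (N ^ m).trace := fun m =>
    Finset.sum_nonneg fun i _ => pow_apply_nonneg hN m i i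
  have hsq : N * N = N.trace • N - N.det • 1 := by
    have h : N.det = N true true * N false false - N true false * N false true := by
      rw [← Matrix.det_submatrix_equiv_self finTwoEquiv N, Matrix.det_fin_two]
      simp [finTwoEquiv]
      ring
    ext i j
    rw [h]
    cases i <;> cases j <;> simp [Matrix.mul_apply, Matrix.trace] <;> ring
  induction k with
  | zero => simp
  | succ k ih =>
    have h : (N ^ (k + 2)).trace = N.trace * (N ^ (k + 1)).trace - N.det * (N ^ k).trace := by
      rw [pow_add, pow_two, hsq, mul_sub, Matrix.mul_smul, Matrix.mul_smul, ← pow_succ, mul_one,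
        Matrix.trace_sub, Matrix.trace_smul, Matrix.trace_smul, smul_eq_mul, smul_eq_mul]
    have h1 : 0 ≤ N.trace := by simpa using htr 1
    rw [h, pow_succ']
    nlinarith [mul_le_mul_of_nonneg_left ih h1, mul_nonneg (neg_nonneg.2 hdet) (htr k)]

/-- Among all steps in a cyclic group of odd order, a generator admits the most step-free sets. -/
theorem stepFreeSum_le_stepFreeSum_one {n : ℕ} [NeZero n] (hn : Odd n) (d : ZMod n) {x : ℝ}
    (hx : 0 ≤ x) : stepFreeSum d x ≤ stepFreeSum (1 : ZMod n) x := by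
  rw [stepFreeSum_one_zmod, stepFreeSum_eq_trace_pow]
  have hcard : addOrderOf d * Nat.card (ZMod n ⧸ AddSubgroup.zmultiples d) = n := by
    have := AddSubgroup.card_eq_card_quotient_mul_card_addSubgroup (AddSubgroup.zmultiples d)
    rw [Nat.card_zmultiples, Nat.card_zmod] at this
    rw [mul_comm, ← this]
  have hodd : Odd (addOrderOf d) := by
    rw [← hcard] at hn
    exact (Nat.odd_mul.1 hn).1
  obtain ⟨k, hk⟩ : ∃ k, Nat.card (ZMod n ⧸ AddSubgroup.zmultiples d) = k + 1 :=
    Nat.exists_eq_succ_of_ne_zero fun h => NeZero.ne n (by rw [← hcard, h, mul_zero])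
  have hM : ∀ i j, 0 ≤ transfer x i j := by
    intro i j
    cases i <;> cases j <;> simp [transfer, hx]
  have hdet : (transfer x).det = -x := by
    rw [← Matrix.det_submatrix_equiv_self finTwoEquiv, Matrix.det_fin_two]
    simp [finTwoEquiv, transfer]
  -- Oddness of `n` enters here: the order of `d` is odd, so the determinant `(-x) ^ addOrderOf d`
  -- is not positive.
  have key := trace_pow_le_trace_pow (N := transfer x ^ addOrderOf d)
    (pow_apply_nonneg hM _) (by
      rw [Matrix.det_pow, hdet, hodd.neg_pow]
      exact neg_nonpos.2 (pow_nonneg hx _)) k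
  rw [← pow_mul, ← hk, hcard] at key
  exact key

/-! ### Failing sets and strong connectivity. -/

section Survives

variable {V : Type*} [Fintype V] [DecidableEq V]

/-- The digraph `G` remains strongly connected when the vertices in `F` fail. -/
def Survives (G : Digraph V) (F : Finset V) : Prop :=
  IsStronglyConnected (inducedSubdigraph G ((Fᶜ : Finset V) : Set V))

open Classical in
/-- The generating function of the sets of vertices whose failure keeps `G` strongly connected. -/
noncomputable def failureSum (G : Digraph V) (x : ℝ) : ℝ :=
  ∑ F : Finset V, if Survives G F then x ^ F.card else 0

theorem reliability_eq_failureSum (G : Digraph V) {p : ℝ} (hp : p ≠ 0) :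
    reliability G p = p ^ Fintype.card V * failureSum G ((1 - p) / p) := by
  classical
  unfold reliability failureSum
  rw [Finset.mul_sum]
  refine Fintype.sum_bijective compl compl_bijective _ _ fun S => ?_
  unfold Survives
  rw [compl_compl, Finset.card_compl]
  split_ifs with h
  · have hle := Finset.card_le_univ S
    obtain ⟨m, hm⟩ := Nat.exists_eq_add_of_le hle
    rw [hm, Nat.add_sub_cancel_left, pow_add, div_pow]
    field_simp
  · simp

/-- Taking `R` to be reachability from a fixed vertex recovers walks. Predicates closed under live
arcs avoid the subtype of operational vertices in later arguments. -/
theorem survives_of_forall_closed {G : Digraph V} {F : Finset V} (hF : F ≠ univ)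
    (h : ∀ R : V → Prop, (∃ r, r ∉ F ∧ R r) →
      (∀ u v, u ∉ F → v ∉ F → R u → G.Adj u v → R v) → ∀ v, v ∉ F → R v) : Survives G F := by
  constructor
  · obtain ⟨v, hv⟩ : ∃ v, v ∉ F := by
      by_contra hcon
      push Not at hcon
      exact hF (Finset.eq_univ_of_forall hcon)
    exact ⟨⟨v, by simpa using hv⟩⟩
  · rintro ⟨u, hu⟩ ⟨v, hv⟩
    have hu' : u ∉ F := by simpa using hu
    have hv' : v ∉ F := by simpa using hv
    obtain ⟨_, h'⟩ := h (fun w => ∃ hw : w ∈ (((Fᶜ : Finset V)) : Set V), Relation.ReflTransGen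
      (inducedSubdigraph G ((Fᶜ : Finset V) : Set V)).Adj ⟨u, hu⟩ ⟨w, hw⟩)
      ⟨u, hu', hu, .refl⟩ (fun w z _ hz ⟨hw, hr⟩ hadj =>
        ⟨by simpa using hz, hr.tail (by exact hadj)⟩) v hv'
    exact h'

theorem Survives.of_closed {G : Digraph V} {F : Finset V} (h : Survives G F) {R : V → Prop}
    (hR : ∀ u v, u ∉ F → v ∉ F → R u → G.Adj u v → R v) {u v : V} (hu : u ∉ F) (hv : v ∉ F)
    (hRu : R u) : R v := by
  have hwalk := h.2 ⟨u, by simpa using hu⟩ ⟨v, by simpa using hv⟩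
  suffices ∀ w, Relation.ReflTransGen (inducedSubdigraph G ((Fᶜ : Finset V) : Set V)).Adj
      ⟨u, by simpa using hu⟩ w → R w by exact this _ hwalk
  intro w hw
  induction hw with
  | refl => exact hRu
  | @tail b c _ hbc ih => exact hR b c (by simpa using b.2) (by simpa using c.2) ih hbc

theorem Survives.ne_univ {G : Digraph V} {F : Finset V} (h : Survives G F) : F ≠ univ := by
  rintro rfl
  obtain ⟨⟨v, hv⟩⟩ := h.1
  simp at hv

theorem survives_of_card {G : Digraph V} {F : Finset V} (h : F.card + 1 = Fintype.card V) :
    Survives G F := by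
  have hc : (Fᶜ).card = 1 := by rw [Finset.card_compl]; omega
  obtain ⟨v, hv⟩ := Finset.card_eq_one.1 hc
  have hF : ∀ w, w ∉ F ↔ w = v := fun w => by rw [← Finset.mem_compl, hv, Finset.mem_singleton]
  refine survives_of_forall_closed (fun h' => ?_) fun R ⟨r, hr, hRr⟩ _ w hw => ?_
  · exact (hF v).2 rfl (h' ▸ mem_univ v)
  · rw [(hF w).1 hw, ← (hF r).1 hr]
    exact hRr

theorem Survives.exists_adj {G : Digraph V} {F : Finset V} (h : Survives G F) {u v : V}
    (hu : u ∉ F) (hv : v ∉ F) (huv : u ≠ v) :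
    (∃ w, w ∉ F ∧ G.Adj u w) ∧ ∃ w, w ∉ F ∧ G.Adj w u := by
  constructor
  · by_contra hcon
    push Not at hcon
    exact huv (h.of_closed (R := fun w => w = u)
      (fun w z _ hz hw hadj => absurd (hw ▸ hadj) (hcon z hz)) hu hv rfl).symm
  · by_contra hcon
    push Not at hcon
    exact h.of_closed (R := fun w => w ≠ u)
      (fun w z hw _ _ hadj hz => hcon w hw (hz ▸ hadj)) hv hu huv.symm rfl

theorem Survives.map {G G' : Digraph V} (e : V ≃ V) (he : ∀ u v, G.Adj u v → G'.Adj (e u) (e v))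
    {F : Finset V} (h : Survives G F) : Survives G' (F.map e.toEmbedding) := by
  refine survives_of_forall_closed (fun h' => h.ne_univ ?_) ?_
  · ext v
    have : e v ∈ F.map e.toEmbedding := h' ▸ mem_univ _
    simpa using this
  · rintro R ⟨r, hr, hRr⟩ hR v hv
    have := h.of_closed (R := fun w => R (e w)) (u := e.symm r) (v := e.symm v)
      (fun u w hu hw hRu hadj => hR _ _ (by simpa using hu) (by simpa using hw) hRu (he _ _ hadj))
      (by simpa [Finset.mem_map_equiv] using hr) (by simpa [Finset.mem_map_equiv] using hv)
      (by simpa using hRr)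
    simpa using this

theorem failureSum_le_of_hom {G G' : Digraph V} (e : V ≃ V)
    (he : ∀ u v, G.Adj u v → G'.Adj (e u) (e v)) {x : ℝ} (hx : 0 ≤ x) :
    failureSum G x ≤ failureSum G' x := by
  classical
  unfold failureSum
  rw [← Equiv.sum_comp e.finsetCongr (fun F => if Survives G' F then x ^ F.card else 0)]
  refine Finset.sum_le_sum fun F _ => ?_
  rw [Equiv.finsetCongr_apply, Finset.card_map]
  split_ifs with h1 h2 h2
  · exact le_rfl
  · exact absurd (h1.map e he) h2
  · positivity
  · exact le_rfl

end Survives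

/-! ### Surviving sets for the steps 2 and 3. -/

section TwoThree

theorem natCast_ne_zero_of_lt {n k : ℕ} (hk : 0 < k) (hkn : k < n) : (k : ZMod n) ≠ 0 := by
  rw [Ne, ZMod.natCast_eq_zero_iff]
  exact fun h => absurd (Nat.le_of_dvd hk h) (by omega)

variable {n : ℕ} [NeZero n]

theorem exists_eq_add_natCast (y v : ZMod n) : ∃ i : ℕ, i < n ∧ v = y + i :=
  ⟨(v - y).val, ZMod.val_lt _, by simp⟩

/-- Once two consecutive vertices are reached, everything live is: of the consecutive in-neighbours
`v - 3`, `v - 2` at least one is live. If no consecutive pair were reached, the walk would be forced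
into constant steps of 2 or of 3, and both numbers are units, so it would meet a consecutive pair
after all. -/
theorem survives_two_three_of_stepFree (hn : 1 < n) (hodd : Odd n) (h3 : ¬ 3 ∣ n)
    {F : Finset (ZMod n)} (hF : StepFree 1 F) : Survives (circulant n {2, 3}) F := by
  have hF' : ∀ w, w ∈ F → w + 1 ∈ F → False := fun w h h' => hF w h h'
  refine survives_of_forall_closed (fun h => hF 0 (h ▸ mem_univ _) (h ▸ mem_univ _)) ?_
  rintro R ⟨r, hr, hRr⟩ hR
  let R' : ZMod n → Prop := fun u => u ∉ F ∧ R u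
  have hR2 : ∀ u, R' u → u + 2 ∉ F → R' (u + 2) := fun u hu h =>
    ⟨h, hR u _ hu.1 h hu.2 (by simp [circulant])⟩
  have hR3 : ∀ u, R' u → u + 3 ∉ F → R' (u + 3) := fun u hu h =>
    ⟨h, hR u _ hu.1 h hu.2 (by simp [circulant])⟩
  by_cases hcons : ∃ w, R' w ∧ R' (w + 1)
  · obtain ⟨w, hw, hw1⟩ := hcons
    have key : ∀ i : ℕ, w + i ∉ F → R' (w + i) := by
      intro i
      induction i using Nat.strong_induction_on with
      | _ i ih =>
        intro hi
        match i, ih, hi with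
        | 0, _, _ => simpa using hw
        | 1, _, _ => simpa using hw1
        | 2, _, hi => exact_mod_cast hR2 w hw (by exact_mod_cast hi)
        | j + 3, ih, hi =>
          have e3 : w + ((j + 3 : ℕ) : ZMod n) = w + j + 3 := by push_cast; ring
          have e2 : w + ((j + 3 : ℕ) : ZMod n) = w + ((j + 1 : ℕ) : ZMod n) + 2 := by
            push_cast; ring
          by_cases hj : w + (j : ZMod n) ∈ F
          · have hj1 : w + ((j + 1 : ℕ) : ZMod n) ∉ F := fun h =>
              hF' _ hj (by push_cast at h; rwa [← add_assoc] at h)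
            rw [e2] at hi ⊢
            exact hR2 _ (ih (j + 1) (by omega) hj1) hi
          · rw [e3] at hi ⊢
            exact hR3 _ (ih j (by omega) hj) hi
    intro v hv
    obtain ⟨i, -, rfl⟩ := exists_eq_add_natCast w v
    exact (key i hv).2
  · exfalso
    push Not at hcons
    by_cases htwo : ∃ s, R' s ∧ R' (s + 2)
    · obtain ⟨s, hs, hs2⟩ := htwo
      have key : ∀ k : ℕ, R' (s + 2 * k) ∧ R' (s + 2 * k + 2) := by
        intro k
        induction k with
        | zero => simpa using ⟨hs, hs2⟩
        | succ k ih =>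
          set t := s + 2 * (k : ZMod n) with ht
          have e : s + 2 * ((k + 1 : ℕ) : ZMod n) = t + 2 := by rw [ht]; push_cast; ring
          rw [e]
          refine ⟨ih.2, hR2 _ ih.2 fun h4 => ?_⟩
          have h3F : t + 3 ∈ F := by
            by_contra h
            have := hcons _ ih.2
            rw [show t + 2 + 1 = t + 3 by ring] at this
            exact this (hR3 _ ih.1 h)
          exact hF' _ h3F (by rwa [show t + 3 + 1 = t + 2 + 2 by ring])
      obtain ⟨m, hm⟩ := hodd
      have h1 := (key (m + 1)).1
      have hz : (2 * m + 1 : ZMod n) = 0 := by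
        have h : (n : ZMod n) = ((2 * m + 1 : ℕ) : ZMod n) := congrArg _ hm
        push_cast at h
        rw [← h, ZMod.natCast_self]
      -- With `n = 2m + 1`, the point `s + 2(m + 1)` is `s + 1`.
      refine hcons s hs ?_
      convert h1 using 1
      push_cast
      linear_combination -hz
    · push Not at htwo
      have key : ∀ k : ℕ, R' (r + 3 * k) := by
        intro k
        induction k with
        | zero => simpa using ⟨hr, hRr⟩
        | succ k ih =>
          have e : r + 3 * ((k + 1 : ℕ) : ZMod n) = r + 3 * (k : ZMod n) + 3 := by push_cast; ring
          rw [e]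
          refine hR3 _ ih fun h => ?_
          have h2 : r + 3 * (k : ZMod n) + 2 ∈ F := by
            by_contra h'
            exact htwo _ ih (hR2 _ ih h')
          exact hF' _ h2 (by rwa [show r + 3 * (k : ZMod n) + 2 + 1 = r + 3 * k + 3 by ring])
      have h3u : (3 : ZMod n) * 3⁻¹ = 1 := by
        have := ZMod.coe_mul_inv_eq_one 3 ((Nat.Prime.coprime_iff_not_dvd Nat.prime_three).2 h3)
        exact_mod_cast this
      refine hcons r (by simpa using key 0) ?_
      convert key (3⁻¹ : ZMod n).val using 2
      rw [ZMod.natCast_zmod_val, h3u]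

/-- The vertex `y + 2` is a hub: every live vertex reaches it and is reached from it. Away from the
single failed pair, one of two consecutive vertices is always live, so walks can advance in either
direction. -/
theorem survives_two_three_of_unique_pair (hn : 7 ≤ n) {F : Finset (ZMod n)} {y : ZMod n}
    (h0 : y ∈ F) (h1 : y + 1 ∈ F) (h2 : y - 2 ∈ F) (h3 : y + 3 ∈ F)
    (huniq : ∀ w, w ∈ F → w + 1 ∈ F → w = y) : Survives (circulant n {2, 3}) F := by
  have hne : ∀ k : ℕ, 0 < k → k < n → (k : ZMod n) ≠ 0 := fun k => natCast_ne_zero_of_lt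
  have hpair : ∀ i : ℕ, 0 < i → i < n → y + i ∈ F → y + ((i + 1 : ℕ) : ZMod n) ∉ F := by
    intro i hi hin hw hw'
    have := huniq _ hw (by push_cast at hw'; rwa [← add_assoc] at hw')
    exact hne i hi hin (by simpa using this)
  have hy2 : y + 2 ∉ F := by simpa using hpair 1 (by omega) (by omega) (by simpa using h1)
  have hy4 : y + 4 ∉ F := by simpa using hpair 3 (by omega) (by omega) (by simpa using h3)
  refine survives_of_forall_closed (fun h => hy2 (h ▸ mem_univ _)) ?_
  rintro R ⟨r, hr, hRr⟩ hR
  let R' : ZMod n → Prop := fun u => u ∉ F ∧ R u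
  have hR2 : ∀ u, R' u → u + 2 ∉ F → R' (u + 2) := fun u hu h =>
    ⟨h, hR u _ hu.1 h hu.2 (by simp [circulant])⟩
  have hR3 : ∀ u, R' u → u + 3 ∉ F → R' (u + 3) := fun u hu h =>
    ⟨h, hR u _ hu.1 h hu.2 (by simp [circulant])⟩
  have e2 : ∀ i : ℕ, y + ((i + 2 : ℕ) : ZMod n) = y + i + 2 := fun i => by push_cast; ring
  have e3 : ∀ i : ℕ, y + ((i + 3 : ℕ) : ZMod n) = y + i + 3 := fun i => by push_cast; ring
  -- Here `j` is the distance still to go to `y + (n + 2) = y + 2`. The pair can only be crossed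
  -- from `y - 1`, by a step of 3; `y - 2` has failed.
  have hback : ∀ j i : ℕ, i + j = n + 2 → R' (y + i) → R' (y + 2) := by
    intro j
    induction j using Nat.strong_induction_on with
    | _ j ih =>
      intro i hij hi
      have hc : ∀ m : ℕ, i + m = n → y + (i : ZMod n) = y - m := by
        intro m hm
        have : (i : ZMod n) + m = 0 := by rw [← Nat.cast_add, hm, ZMod.natCast_self]
        linear_combination this
      match j, ih, hij with
      | 0, _, hij =>
        have : (i : ZMod n) = 2 := by rw [show i = n + 2 by omega]; simp
        rwa [this] at hi
      | 1, _, hij =>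
        have : (i : ZMod n) = 1 := by rw [show i = n + 1 by omega]; simp
        rw [this] at hi
        exact absurd h1 hi.1
      | 2, _, hij =>
        rw [hc 0 (by omega)] at hi
        exact absurd (by simpa using h0) hi.1
      | 3, _, hij =>
        have e : y + (i : ZMod n) + 3 = y + 2 := by rw [hc 1 (by omega)]; push_cast; ring
        have := hR3 _ hi (by rwa [e])
        rwa [e] at this
      | 4, _, hij =>
        rw [hc 2 (by omega)] at hi
        exact absurd (by simpa using h2) hi.1
      | j + 5, ih, hij =>
        by_cases hF : y + ((i + 2 : ℕ) : ZMod n) ∈ F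
        · have hF3 : y + ((i + 3 : ℕ) : ZMod n) ∉ F := hpair (i + 2) (by omega) (by omega) hF
          refine ih (j + 2) (by omega) (i + 3) (by omega) ?_
          rw [e3] at hF3 ⊢
          exact hR3 _ hi hF3
        · refine ih (j + 3) (by omega) (i + 2) (by omega) ?_
          rw [e2] at hF ⊢
          exact hR2 _ hi hF
  have hy2R : R' (y + 2) := by
    obtain ⟨i, hi, hri⟩ := exists_eq_add_natCast y r
    exact hback (n + 2 - i) i (by omega) (hri ▸ ⟨hr, hRr⟩)
  have hforw : ∀ i : ℕ, i + 2 ≤ n → y + ((i + 4 : ℕ) : ZMod n) ∉ F →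
      R' (y + ((i + 4 : ℕ) : ZMod n)) := by
    have e4 : y + ((0 + 4 : ℕ) : ZMod n) = y + 2 + 2 := by push_cast; ring
    have h4 : R' (y + ((0 + 4 : ℕ) : ZMod n)) := by
      rw [e4]
      exact hR2 _ hy2R (by rwa [add_assoc, show (2 + 2 : ZMod n) = 4 by norm_num])
    intro i
    induction i using Nat.strong_induction_on with
    | _ i ih =>
      intro hin hi
      match i, ih, hin, hi with
      | 0, _, _, _ => exact h4
      | 1, _, _, hi =>
        have e : y + ((1 + 4 : ℕ) : ZMod n) = y + 2 + 3 := by push_cast; ring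
        rw [e] at hi ⊢
        exact hR3 _ hy2R hi
      | 2, _, _, hi =>
        have e : y + ((2 + 4 : ℕ) : ZMod n) = y + ((0 + 4 : ℕ) : ZMod n) + 2 := by push_cast; ring
        rw [e] at hi ⊢
        exact hR2 _ h4 hi
      | j + 3, ih, hin, hi =>
        have e : y + ((j + 3 + 4 : ℕ) : ZMod n) = y + ((j + 4 : ℕ) : ZMod n) + 3 := by
          push_cast; ring
        have e' : y + ((j + 3 + 4 : ℕ) : ZMod n) = y + ((j + 1 + 4 : ℕ) : ZMod n) + 2 := by
          push_cast; ring
        by_cases hF : y + ((j + 4 : ℕ) : ZMod n) ∈ F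
        · have hF' : y + ((j + 1 + 4 : ℕ) : ZMod n) ∉ F := by
            have := hpair (j + 4) (by omega) (by omega) hF
            rwa [show j + 4 + 1 = j + 1 + 4 by omega] at this
          rw [e'] at hi ⊢
          exact hR2 _ (ih (j + 1) (by omega) (by omega) hF') hi
        · rw [e] at hi ⊢
          exact hR3 _ (ih j (by omega) (by omega) hF) hi
  intro v hv
  obtain ⟨i, hi, hvi⟩ := exists_eq_add_natCast (y + 4) v
  have hvi' : v = y + ((i + 4 : ℕ) : ZMod n) := by rw [hvi]; push_cast; ring
  by_cases hin : i + 2 ≤ n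
  · rw [hvi'] at hv ⊢
    exact (hforw i hin hv).2
  · exfalso
    apply hv
    rw [hvi', show i + 4 = n + 3 by omega]
    simpa using h3

end TwoThree

/-! ### Comparing generating functions. -/

section Sums

/-- The sets of size at least `k` contribute little to a generating function near `0`. -/
theorem sum_pow_card_le {A : Type*} [Fintype A] (𝒜 : Finset (Finset A)) {k : ℕ}
    (h𝒜 : ∀ F ∈ 𝒜, k ≤ F.card) {x : ℝ}
    (hx : 0 ≤ x) (hx1 : x ≤ 1) :
    ∑ F ∈ 𝒜, x ^ F.card ≤ 2 ^ Fintype.card A * x ^ k := by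
  refine (Finset.sum_le_card_nsmul 𝒜 _ (x ^ k) fun F hF =>
    pow_le_pow_of_le_one hx hx1 (h𝒜 F hF)).trans ?_
  rw [nsmul_eq_mul]
  refine mul_le_mul_of_nonneg_right ?_ (pow_nonneg hx _)
  have : 𝒜.card ≤ 2 ^ Fintype.card A := by
    simpa using Finset.card_le_univ 𝒜
  exact_mod_cast this

theorem sum_powersetCard_pow {A : Type*} [Fintype A] (x : ℝ) (hA : 0 < Fintype.card A) :
    ∑ F ∈ powersetCard (Fintype.card A - 1) (univ : Finset A), x ^ F.card =
      Fintype.card A * x ^ (Fintype.card A - 1) := by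
  rw [Finset.sum_congr rfl fun F hF => by rw [(Finset.mem_powersetCard.1 hF).2], Finset.sum_const,
    Finset.card_powersetCard, Finset.card_univ, nsmul_eq_mul,
    Nat.choose_symm_of_eq_add (Nat.sub_add_cancel hA).symm, Nat.choose_one_right]

variable {A : Type*} [AddCommGroup A] [Fintype A] [DecidableEq A]

theorem stepFreeSum_add_le_failureSum {G : Digraph A} {d : A} {x : ℝ} (hx : 0 ≤ x)
    (𝒜 : Finset (Finset A)) (hfree : ∀ F, StepFree d F → Survives G F)
    (h𝒜 : ∀ F ∈ 𝒜, Survives G F ∧ ¬ StepFree d F) :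
    stepFreeSum d x + ∑ F ∈ 𝒜, x ^ F.card ≤ failureSum G x := by
  classical
  unfold stepFreeSum failureSum
  rw [← Finset.sum_filter, ← Finset.sum_filter, ← Finset.sum_union]
  · refine Finset.sum_le_sum_of_subset_of_nonneg (fun F hF => ?_) fun _ _ _ => pow_nonneg hx _
    rw [Finset.mem_filter]
    refine ⟨mem_univ _, ?_⟩
    rcases Finset.mem_union.1 hF with h | h
    · exact hfree F (Finset.mem_filter.1 h).2
    · exact (h𝒜 F h).1
  · rw [Finset.disjoint_left]
    exact fun F h h' => (h𝒜 F h').2 (Finset.mem_filter.1 h).2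

theorem failureSum_add_le_stepFreeSum_add {G : Digraph A} {d : A} {x : ℝ} (hx : 0 ≤ x)
    (𝒜 ℬ : Finset (Finset A)) (h𝒜 : ∀ F, Survives G F → StepFree d F ∨ F ∈ 𝒜)
    (hℬ : ∀ F ∈ ℬ, StepFree d F ∧ ¬ Survives G F) :
    failureSum G x + ∑ F ∈ ℬ, x ^ F.card ≤ stepFreeSum d x + ∑ F ∈ 𝒜, x ^ F.card := by
  classical
  unfold stepFreeSum failureSum
  rw [← Finset.sum_filter, ← Finset.sum_filter, ← Finset.sum_union]
  · refine (Finset.sum_le_sum_of_subset_of_nonneg (t := univ.filter (StepFree d) ∪ 𝒜)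
      (fun F hF => ?_) fun _ _ _ => pow_nonneg hx _).trans ?_
    · rw [Finset.mem_union, Finset.mem_filter]
      rcases Finset.mem_union.1 hF with h | h
      · exact (h𝒜 F (Finset.mem_filter.1 h).2).imp (fun h => ⟨mem_univ _, h⟩) id
      · exact Or.inl ⟨mem_univ _, (hℬ F h).1⟩
    · rw [← Finset.sum_union_inter]
      exact le_add_of_nonneg_right (Finset.sum_nonneg fun _ _ => pow_nonneg hx _)
  · rw [Finset.disjoint_left]
    exact fun F h h' => (hℬ F h').2 (Finset.mem_filter.1 h).2

theorem failureSum_le_stepFreeSum_add {G : Digraph A} {d : A} {x : ℝ} (hx : 0 ≤ x)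
    (𝒜 : Finset (Finset A)) (h𝒜 : ∀ F, Survives G F → StepFree d F ∨ F ∈ 𝒜) :
    failureSum G x ≤ stepFreeSum d x + ∑ F ∈ 𝒜, x ^ F.card := by
  simpa using failureSum_add_le_stepFreeSum_add hx 𝒜 ∅ h𝒜 (by simp)

end Sums

/-! ### Lower bounds for the steps 2 and 3. -/

section LowerBounds

theorem card_quadruple {R : Type*} [CommRing R] [DecidableEq R] {u : R}
    (h2 : 2 * u ≠ 0) (h3 : 3 * u ≠ 0) (h5 : 5 * u ≠ 0) (y : R) :
    #({y - 2 * u, y, y + u, y + 3 * u} : Finset R) = 4 := by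
  grind

theorem card_octuple {R : Type*} [CommRing R] [DecidableEq R] {u : R} (h1 : u ≠ 0) (h2 : 2 * u ≠ 0)
    (h3 : 3 * u ≠ 0) (h4 : 4 * u ≠ 0) (h5 : 5 * u ≠ 0) (h6 : 6 * u ≠ 0) (h7 : 7 * u ≠ 0) :
    #({-3 * u, -2 * u, -u, 0, u, 2 * u, 3 * u, 4 * u} : Finset R) = 8 := by
  rw [card_insert_of_notMem, card_insert_of_notMem, card_insert_of_notMem, card_insert_of_notMem,
    card_insert_of_notMem, card_insert_of_notMem, card_insert_of_notMem, card_singleton] <;>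
    simp only [mem_insert, mem_singleton] <;> grind

variable {n : ℕ} [NeZero n]

theorem stepFreeSum_add_singletons_le (hn : 3 ≤ n) (hodd : Odd n) (h3 : ¬ 3 ∣ n) {x : ℝ}
    (hx : 0 ≤ x) :
    stepFreeSum (1 : ZMod n) x + n * x ^ (n - 1) ≤ failureSum (circulant n {2, 3}) x := by
  have h := sum_powersetCard_pow (A := ZMod n) x (by rw [ZMod.card]; omega)
  rw [ZMod.card] at h
  rw [← h]
  refine stepFreeSum_add_le_failureSum hx _
    (fun F => survives_two_three_of_stepFree (by omega) hodd h3) fun F hF => ?_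
  have hc : F.card + 1 = n := by
    have := (Finset.mem_powersetCard.1 hF).2
    omega
  refine ⟨survives_of_card (by rw [ZMod.card, hc]), fun hfree => ?_⟩
  have hcompl : (Fᶜ).card = 1 := by rw [Finset.card_compl, ZMod.card]; omega
  obtain ⟨v, hv⟩ := Finset.card_eq_one.1 hcompl
  have hF : ∀ w, w ≠ v → w ∈ F := fun w hw => by
    by_contra h
    rw [← Finset.mem_compl, hv, Finset.mem_singleton] at h
    exact hw h
  have h1 : ((1 : ℕ) : ZMod n) ≠ 0 := natCast_ne_zero_of_lt (by omega) (by omega)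
  have h2 : ((2 : ℕ) : ZMod n) ≠ 0 := natCast_ne_zero_of_lt (by omega) (by omega)
  refine hfree (v + 1) (hF _ fun h => h1 ?_) (hF _ fun h => h2 ?_)
  · push_cast
    linear_combination h
  · push_cast
    linear_combination h

theorem stepFreeSum_add_quadruples_le (hn : 11 ≤ n) (hodd : Odd n) (h3 : ¬ 3 ∣ n) {x : ℝ}
    (hx : 0 ≤ x) :
    stepFreeSum (1 : ZMod n) x + (n * x ^ 4 + n * (n - 8) * x ^ 5) ≤
      failureSum (circulant n {2, 3}) x := by
  have hne : ∀ k : ℕ, 0 < k → k < n → (k : ZMod n) ≠ 0 := fun k => natCast_ne_zero_of_lt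
  have c1 : (1 : ZMod n) ≠ 0 := by exact_mod_cast hne 1 (by omega) (by omega)
  have c2 : (2 : ZMod n) ≠ 0 := by exact_mod_cast hne 2 (by omega) (by omega)
  have c3 : (3 : ZMod n) ≠ 0 := by exact_mod_cast hne 3 (by omega) (by omega)
  have c4 : (4 : ZMod n) ≠ 0 := by exact_mod_cast hne 4 (by omega) (by omega)
  have c5 : (5 : ZMod n) ≠ 0 := by exact_mod_cast hne 5 (by omega) (by omega)
  have c6 : (6 : ZMod n) ≠ 0 := by exact_mod_cast hne 6 (by omega) (by omega)
  have c7 : (7 : ZMod n) ≠ 0 := by exact_mod_cast hne 7 (by omega) (by omega)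
  let quad : ZMod n → Finset (ZMod n) := fun y => {y - 2, y, y + 1, y + 3}
  -- `quad 0` together with all its neighbours at distance 1. Adding `y + z` with `z ∉ O` creates no
  -- second consecutive pair, so `y`, and then `z`, can be read off from the 5-set.
  let O : Finset (ZMod n) := {-3, -2, -1, 0, 1, 2, 3, 4}
  have hquad : ∀ y, (quad y).card = 4 := by
    intro y
    have := card_quadruple (u := (1 : ZMod n)) (by simpa) (by simpa) (by simpa) y
    simpa [quad] using this
  have hO : O.card = 8 := by
    have := card_octuple (u := (1 : ZMod n)) (by simpa) (by simpa) (by simpa) (by simpa)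
      (by simpa) (by simpa) (by simpa)
    simpa [O] using this
  have huniq : ∀ y w, w ∈ quad y → w + 1 ∈ quad y → w = y := by
    intro y w
    simp only [quad, mem_insert, mem_singleton]
    grind
  have huniq' : ∀ y z w, z ∉ O → w ∈ insert (y + z) (quad y) → w + 1 ∈ insert (y + z) (quad y) →
      w = y := by
    intro y z w
    simp only [O, quad, mem_insert, mem_singleton]
    grind
  have hnot : ∀ y z, z ∉ O → y + z ∉ quad y := by
    intro y z
    simp only [O, quad, mem_insert, mem_singleton]
    grind
  have hmem : ∀ y, y ∈ quad y ∧ y + 1 ∈ quad y ∧ y - 2 ∈ quad y ∧ y + 3 ∈ quad y := by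
    intro y
    simp [quad]
  let 𝒬 : Finset (Finset (ZMod n)) := univ.image quad
  let 𝒮 : Finset (Finset (ZMod n)) :=
    (univ ×ˢ Oᶜ).image fun p : ZMod n × ZMod n => insert (p.1 + p.2) (quad p.1)
  have h𝒬4 : ∀ F ∈ 𝒬, F.card = 4 := by
    intro F hF
    obtain ⟨y, -, rfl⟩ := Finset.mem_image.1 hF
    exact hquad y
  have h𝒮5 : ∀ F ∈ 𝒮, F.card = 5 := by
    intro F hF
    obtain ⟨⟨y, z⟩, hz, rfl⟩ := Finset.mem_image.1 hF
    rw [card_insert_of_notMem (hnot y z (by simpa using hz)), hquad]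
  have h𝒬 : 𝒬.card = n := by
    rw [Finset.card_image_of_injective, Finset.card_univ, ZMod.card]
    intro y y' h
    exact huniq _ _ (h ▸ (hmem y).1) (h ▸ (hmem y).2.1)
  have h𝒮 : 𝒮.card = n * (n - 8) := by
    rw [Finset.card_image_of_injOn, Finset.card_product, Finset.card_univ, Finset.card_compl, hO,
      ZMod.card]
    rintro ⟨y, z⟩ hz ⟨y', z'⟩ hz' h
    have hzO : z ∉ O := by simpa using hz
    have hzO' : z' ∉ O := by simpa using hz'
    dsimp only at h
    obtain rfl : y = y' := huniq' y' z' y hzO' (h ▸ mem_insert_of_mem (hmem y).1)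
      (h ▸ mem_insert_of_mem (hmem y).2.1)
    have : y + z ∈ insert (y + z') (quad y) := h ▸ mem_insert_self _ _
    rcases Finset.mem_insert.1 this with h' | h'
    · rw [add_left_cancel h']
    · exact absurd h' (hnot y z hzO)
  have hsum : ∑ F ∈ 𝒬 ∪ 𝒮, x ^ F.card = n * x ^ 4 + n * (n - 8) * x ^ 5 := by
    rw [Finset.sum_union, Finset.sum_congr rfl fun F hF => by rw [h𝒬4 F hF],
      Finset.sum_congr (s₁ := 𝒮) rfl fun F hF => by rw [h𝒮5 F hF], Finset.sum_const,
      Finset.sum_const, h𝒬, h𝒮, nsmul_eq_mul, nsmul_eq_mul, Nat.cast_mul,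
      Nat.cast_sub (by omega), Nat.cast_ofNat]
    rw [Finset.disjoint_left]
    intro F h h'
    have := h𝒬4 F h
    have := h𝒮5 F h'
    omega
  rw [← hsum]
  refine stepFreeSum_add_le_failureSum hx _
    (fun F => survives_two_three_of_stepFree (by omega) hodd h3) fun F hF => ?_
  rcases Finset.mem_union.1 hF with h | h
  · obtain ⟨y, -, rfl⟩ := Finset.mem_image.1 h
    obtain ⟨m0, m1, m2, m3⟩ := hmem y
    exact ⟨survives_two_three_of_unique_pair (by omega) m0 m1 m2 m3 (huniq y),
      fun hfree => hfree y m0 m1⟩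
  · obtain ⟨⟨y, z⟩, hz, rfl⟩ := Finset.mem_image.1 h
    have hzO : z ∉ O := by simpa using hz
    obtain ⟨m0, m1, m2, m3⟩ := hmem y
    exact ⟨survives_two_three_of_unique_pair (by omega) (mem_insert_of_mem m0)
      (mem_insert_of_mem m1) (mem_insert_of_mem m2) (mem_insert_of_mem m3)
      fun w => huniq' y z w hzO,
      fun hfree => hfree y (mem_insert_of_mem m0) (mem_insert_of_mem m1)⟩

end LowerBounds

/-! ### Upper bounds for the competitors. -/

section UpperBounds

variable {n : ℕ}

theorem exists_mul_eq_one {b : ZMod n} (h : AddSubgroup.zmultiples b = ⊤) : ∃ c, c * b = 1 := by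
  obtain ⟨k, hk⟩ : (1 : ZMod n) ∈ AddSubgroup.zmultiples b := h ▸ AddSubgroup.mem_top _
  exact ⟨k, by simpa using hk⟩

theorem closure_pair_eq_zmultiples {a b c : ZMod n} (ha : a ∈ AddSubgroup.zmultiples c)
    (hb : b ∈ AddSubgroup.zmultiples c) (h : AddSubgroup.closure {a, b} = ⊤) :
    AddSubgroup.zmultiples c = ⊤ := by
  rw [eq_top_iff, ← h, AddSubgroup.closure_le]
  rintro v (rfl | rfl)
  · exact ha
  · exact hb

theorem card_image_add_left (y : ZMod n) (F : Finset (ZMod n)) :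
    (F.image (y + ·)).card = F.card :=
  Finset.card_image_of_injective _ (add_right_injective y)

/-- The closure property of a set of failed vertices of `Γ(ℤ_n, {a, b})` that leaves every
operational vertex with an operational out-neighbour and an operational in-neighbour. -/
def PairClosed (a b : ZMod n) (F : Finset (ZMod n)) : Prop :=
  ∀ w, w ∈ F → w + (b - a) ∈ F → w - a ∈ F ∧ w + b ∈ F

/-- The smallest set containing `0` and `b - a` that can be
pair-closed. -/
def quadruple (a b : ZMod n) : Finset (ZMod n) := {-a, 0, b - a, b}

theorem PairClosed.exists_quadruple {a b : ZMod n} {F : Finset (ZMod n)} (hF : PairClosed a b F)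
    (hfree : ¬ StepFree (b - a) F) : ∃ y, (quadruple a b).image (y + ·) ⊆ F := by
  unfold StepFree at hfree
  push Not at hfree
  obtain ⟨w, hw, hwd⟩ := hfree
  obtain ⟨h1, h2⟩ := hF w hw hwd
  refine ⟨w, fun v hv => ?_⟩
  obtain ⟨q, hq, rfl⟩ := Finset.mem_image.1 hv
  simp only [quadruple, mem_insert, mem_singleton] at hq
  rcases hq with rfl | rfl | rfl | rfl
  · rwa [← sub_eq_add_neg]
  · rwa [add_zero]
  · exact hwd
  · exact h2

theorem PairClosed.exists_insert {a b : ZMod n} (hQ : (quadruple a b).card = 4)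
    {F : Finset (ZMod n)} (hF : PairClosed a b F) (hfree : ¬ StepFree (b - a) F)
    (hcard : F.card = 5) : ∃ y z, z ∉ quadruple a b ∧
      F = (insert z (quadruple a b)).image (y + ·) ∧ PairClosed a b (insert z (quadruple a b)) := by
  obtain ⟨y, hy⟩ := hF.exists_quadruple hfree
  have hc : ((quadruple a b).image (y + ·)).card = 4 := by rw [card_image_add_left, hQ]
  obtain ⟨v, hv, hvF⟩ : ∃ v ∉ (quadruple a b).image (y + ·),
      F = insert v ((quadruple a b).image (y + ·)) := by
    obtain ⟨v, hv⟩ := Finset.card_eq_one.1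
      (show (F \ (quadruple a b).image (y + ·)).card = 1 by
        rw [Finset.card_sdiff_of_subset hy, hc, hcard])
    have hv' : v ∈ F \ (quadruple a b).image (y + ·) := hv ▸ mem_singleton_self v
    refine ⟨v, (mem_sdiff.1 hv').2, ?_⟩
    rw [Finset.insert_eq, ← hv, Finset.sdiff_union_of_subset hy]
  have hFe : F = (insert (v - y) (quadruple a b)).image (y + ·) := by
    rw [Finset.image_insert, add_sub_cancel]
    exact hvF
  refine ⟨y, v - y, fun h => hv (Finset.mem_image.2 ⟨_, h, by ring⟩), hFe, ?_⟩
  have hmem : ∀ w, w ∈ insert (v - y) (quadruple a b) ↔ y + w ∈ F := by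
    intro w
    rw [hFe, Finset.mem_image]
    exact ⟨fun h => ⟨w, h, rfl⟩, fun ⟨w', h, e⟩ => add_left_cancel e ▸ h⟩
  intro w hw hwd
  rw [hmem] at hw hwd ⊢
  rw [hmem, add_sub_assoc', ← add_assoc]
  exact hF (y + w) hw (by rwa [add_assoc])

variable [NeZero n]

theorem Survives.pairClosed {a b : ZMod n} {F : Finset (ZMod n)}
    (h : Survives (circulant n {a, b}) F) (hF : F.card + 2 ≤ n) : PairClosed a b F := by
  have hexists : ∀ u, ∃ v, v ∉ F ∧ u ≠ v := by
    intro u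
    by_contra! hcon
    have hsub : (univ : Finset (ZMod n)) ⊆ insert u F := fun v _ => by
      by_cases hv : v ∈ F
      · exact mem_insert_of_mem hv
      · exact mem_insert.2 (Or.inl (hcon v hv).symm)
    have h1 := Finset.card_le_card hsub
    have h2 := Finset.card_insert_le u F
    rw [Finset.card_univ, ZMod.card] at h1
    omega
  intro w hw hwd
  constructor
  · by_contra hwa
    obtain ⟨v, hv, hne⟩ := hexists (w - a)
    obtain ⟨⟨z, hz, hadj⟩, -⟩ := h.exists_adj hwa hv hne
    rcases hadj with hadj | hadj
    · exact hz (by rwa [show z = w by linear_combination hadj])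
    · replace hadj : z - (w - a) = b := hadj
      exact hz (by rwa [show z = w + (b - a) by linear_combination hadj])
  · by_contra hwb
    obtain ⟨v, hv, hne⟩ := hexists (w + b)
    obtain ⟨-, ⟨z, hz, hadj⟩⟩ := h.exists_adj hwb hv hne
    rcases hadj with hadj | hadj
    · exact hz (by rwa [show z = w + (b - a) by linear_combination -hadj])
    · replace hadj : w + b - z = b := hadj
      exact hz (by rwa [show z = w by linear_combination -hadj])

theorem Survives.card_lt {G : Digraph (ZMod n)} {F : Finset (ZMod n)} (h : Survives G F) :
    F.card < n := by
  have := Finset.card_lt_univ_of_notMem (x := h.1.some.1) (by simpa using h.1.some.2)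
  rwa [ZMod.card] at this

/-- A failed pair `w`, `w - b` forces `w - 2b` to fail, and so on along all multiples of the
generator `b`. Only complements of single vertices can therefore survive without being step-free. -/
theorem failureSum_le_of_eq_two_mul {b : ZMod n} (hb : AddSubgroup.closure {2 * b, b} = ⊤)
    {x : ℝ} (hx : 0 ≤ x) :
    failureSum (circulant n {2 * b, b}) x ≤ stepFreeSum (b - 2 * b) x + n * x ^ (n - 1) := by
  have hs := sum_powersetCard_pow (A := ZMod n) x Fintype.card_pos
  rw [ZMod.card] at hs
  rw [← hs]
  refine failureSum_le_stepFreeSum_add hx _ fun F hF => ?_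
  have hlt := hF.card_lt
  by_cases hcard : F.card + 2 ≤ n
  · left
    intro w hw hwd
    have hclosed := hF.pairClosed hcard
    have key : ∀ k : ℕ, w - k * b ∈ F ∧ w - k * b - b ∈ F := by
      intro k
      induction k with
      | zero => exact ⟨by simpa, by simpa [show w - b = w + (b - 2 * b) by ring]⟩
      | succ k ih =>
        have e : w - ((k + 1 : ℕ) : ZMod n) * b = w - k * b - b := by push_cast; ring
        rw [e]
        refine ⟨ih.2, ?_⟩
        have := (hclosed _ ih.1 (by
          rw [show w - k * b + (b - 2 * b) = w - k * b - b by ring]; exact ih.2)).1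
        rwa [show w - k * b - b - b = w - k * b - 2 * b by ring]
    obtain ⟨c, hc⟩ := exists_mul_eq_one (closure_pair_eq_zmultiples
      (AddSubgroup.mem_zmultiples_iff.2 ⟨2, by simp⟩) (AddSubgroup.mem_zmultiples b) hb)
    refine hF.ne_univ (Finset.eq_univ_of_forall fun v => ?_)
    have := (key ((w - v) * c).val).1
    rwa [ZMod.natCast_zmod_val, mul_assoc, hc, mul_one, sub_sub_cancel] at this
  · right
    rw [Finset.mem_powersetCard]
    exact ⟨subset_univ _, by omega⟩

/-- The graph is an undirected cycle. The step-free set `{0, 3a}` walls off `{a, 2a}` and so does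
not survive, which costs `x ^ 2`. A surviving set that is not step-free has at least three elements,
since `w` and `w - 2a` force `w - a`. -/
theorem failureSum_le_of_neg (hn : 5 ≤ n) {a : ZMod n} (h1 : a ≠ 0) (h2 : 2 * a ≠ 0)
    (h3 : 3 * a ≠ 0) (h4 : 4 * a ≠ 0) (h5 : 5 * a ≠ 0) {x : ℝ} (hx : 0 ≤ x) (hx1 : x ≤ 1) :
    failureSum (circulant n {a, -a}) x + x ^ 2 ≤ stepFreeSum (-a - a) x + 2 ^ n * x ^ 3 := by
  have hA := sum_pow_card_le (univ.filter fun F : Finset (ZMod n) => 3 ≤ F.card) (k := 3)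
    (fun F hF => (Finset.mem_filter.1 hF).2) hx hx1
  rw [ZMod.card] at hA
  have hB : ∑ F ∈ ({{0, 3 * a}} : Finset (Finset (ZMod n))), x ^ F.card = x ^ 2 := by
    rw [Finset.sum_singleton, Finset.card_pair h3.symm]
  rw [← hB]
  refine (failureSum_add_le_stepFreeSum_add hx _ _ (fun F hF => ?_) fun F hF => ?_).trans
    (add_le_add_right hA _)
  · rw [or_iff_not_imp_left]
    intro hfree
    rw [Finset.mem_filter]
    refine ⟨mem_univ _, ?_⟩
    by_cases hcard : F.card + 2 ≤ n
    · unfold StepFree at hfree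
      push Not at hfree
      obtain ⟨w, hw, hwd⟩ := hfree
      have hwa := (hF.pairClosed hcard w hw hwd).1
      refine le_trans ?_ (Finset.card_le_card (s := {w, w + (-a - a), w - a}) ?_)
      · rw [Finset.card_eq_three.2 ⟨_, _, _, ?_, ?_, ?_, rfl⟩] <;> grind
      · intro v hv
        simp only [mem_insert, mem_singleton] at hv
        rcases hv with rfl | rfl | rfl <;> assumption
    · omega
  · obtain rfl := Finset.mem_singleton.1 hF
    constructor
    · intro w
      simp only [mem_insert, mem_singleton]
      rintro (rfl | rfl) <;> grind
    · intro hS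
      have := hS.of_closed (R := fun w => w = a ∨ w = 2 * a) (u := a) (v := -a) (by
        rintro u v hu hv hR (hadj | hadj)
        · simp only [mem_insert, mem_singleton] at hu hv
          grind
        · replace hadj : v - u = -a := hadj
          simp only [mem_insert, mem_singleton] at hu hv
          grind) (by simp only [mem_insert, mem_singleton]; grind)
        (by simp only [mem_insert, mem_singleton]; grind) (Or.inl rfl)
      grind

/-- Each `z` outside the nine elements of `quadruple a b ∪ B` gives at most `n` translates, whence
the coefficient `n(n - 9)`. -/
theorem failureSum_le_of_extensions {a b : ZMod n} (hQ : (quadruple a b).card = 4)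
    {B : Finset (ZMod n)} (hB : B.card = 5) (hdisj : Disjoint (quadruple a b) B)
    (hext : ∀ F, PairClosed a b F → ¬ StepFree (b - a) F → F.card = 5 →
      ∃ y z, z ∉ quadruple a b ∪ B ∧ F = (insert z (quadruple a b)).image (y + ·))
    {x : ℝ} (hx : 0 ≤ x) (hx1 : x ≤ 1) :
    9 ≤ n ∧ failureSum (circulant n {a, b}) x ≤
      stepFreeSum (b - a) x + (n * x ^ 4 + n * (n - 9) * x ^ 5 + 2 ^ n * x ^ 6) := by
  have hQB : (quadruple a b ∪ B).card = 9 := by rw [Finset.card_union_of_disjoint hdisj, hQ, hB]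
  have hn9 : 9 ≤ n := by
    have := Finset.card_le_univ (quadruple a b ∪ B)
    rwa [hQB, ZMod.card] at this
  let 𝒬 : Finset (Finset (ZMod n)) := univ.image fun y => (quadruple a b).image (y + ·)
  let 𝒮 : Finset (Finset (ZMod n)) := (univ ×ˢ (quadruple a b ∪ B)ᶜ).image
    fun p : ZMod n × ZMod n => (insert p.2 (quadruple a b)).image (p.1 + ·)
  let 𝒯 : Finset (Finset (ZMod n)) := univ.filter fun F => 6 ≤ F.card
  have h𝒬 : ∑ F ∈ 𝒬, x ^ F.card ≤ n * x ^ 4 := by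
    rw [Finset.sum_congr rfl fun F hF => show x ^ F.card = x ^ 4 by
      obtain ⟨y, -, rfl⟩ := Finset.mem_image.1 hF
      rw [card_image_add_left, hQ], Finset.sum_const, nsmul_eq_mul]
    refine mul_le_mul_of_nonneg_right ?_ (pow_nonneg hx _)
    have := Finset.card_image_le (s := (univ : Finset (ZMod n)))
      (f := fun y => (quadruple a b).image (y + ·))
    rw [Finset.card_univ, ZMod.card] at this
    exact_mod_cast this
  have h𝒮 : ∑ F ∈ 𝒮, x ^ F.card ≤ n * (n - 9) * x ^ 5 := by
    rw [Finset.sum_congr rfl fun F hF => show x ^ F.card = x ^ 5 by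
      obtain ⟨⟨y, z⟩, hz, rfl⟩ := Finset.mem_image.1 hF
      have hz' : z ∉ quadruple a b := fun h => by simp [h] at hz
      rw [card_image_add_left, Finset.card_insert_of_notMem hz', hQ], Finset.sum_const,
      nsmul_eq_mul]
    refine mul_le_mul_of_nonneg_right ?_ (pow_nonneg hx _)
    have := Finset.card_image_le (s := univ ×ˢ (quadruple a b ∪ B)ᶜ)
      (f := fun p : ZMod n × ZMod n => (insert p.2 (quadruple a b)).image (p.1 + ·))
    rw [Finset.card_product, Finset.card_univ, Finset.card_compl, hQB, ZMod.card] at this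
    calc (𝒮.card : ℝ) ≤ ((n * (n - 9) : ℕ) : ℝ) := by exact_mod_cast this
      _ = n * (n - 9) := by rw [Nat.cast_mul, Nat.cast_sub hn9, Nat.cast_ofNat]
  have h𝒯 : ∑ F ∈ 𝒯, x ^ F.card ≤ 2 ^ n * x ^ 6 := by
    have := sum_pow_card_le 𝒯 (k := 6) (fun F hF => (Finset.mem_filter.1 hF).2) hx hx1
    rwa [ZMod.card] at this
  have hunion : ∀ 𝒰 𝒱 : Finset (Finset (ZMod n)),
      ∑ F ∈ 𝒰 ∪ 𝒱, x ^ F.card ≤ ∑ F ∈ 𝒰, x ^ F.card + ∑ F ∈ 𝒱, x ^ F.card := by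
    intro 𝒰 𝒱
    rw [← Finset.sum_union_inter]
    exact le_add_of_nonneg_right (Finset.sum_nonneg fun _ _ => pow_nonneg hx _)
  refine ⟨hn9, (failureSum_le_stepFreeSum_add (d := b - a) hx (𝒬 ∪ 𝒮 ∪ 𝒯) fun F hF => ?_).trans ?_⟩
  · rw [or_iff_not_imp_left]
    intro hfree
    by_cases h6 : 6 ≤ F.card
    · exact mem_union_right _ (Finset.mem_filter.2 ⟨mem_univ _, h6⟩)
    · refine mem_union_left _ ?_
      have hclosed := hF.pairClosed (by omega)
      obtain ⟨y, hy⟩ := hclosed.exists_quadruple hfree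
      have hle := Finset.card_le_card hy
      rw [card_image_add_left, hQ] at hle
      rcases (show F.card = 4 ∨ F.card = 5 by omega) with h4 | h5
      · refine mem_union_left _ (Finset.mem_image.2 ⟨y, mem_univ _, ?_⟩)
        exact Finset.eq_of_subset_of_card_le hy (by rw [card_image_add_left, hQ, h4])
      · obtain ⟨y, z, hz, rfl⟩ := hext F hclosed hfree h5
        exact mem_union_right _ (Finset.mem_image.2 ⟨(y, z), by simpa using hz, rfl⟩)
  · have h1 := hunion (𝒬 ∪ 𝒮) 𝒯
    have h2 := hunion 𝒬 𝒮
    linarith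

end UpperBounds

/-! ### Five excluded extensions of the quadruple. -/

section Generic

variable {n : ℕ}

theorem card_quadruple_eq_four {a b : ZMod n} (ha : a ≠ 0) (hb : b ≠ 0) (hab : a ≠ b)
    (hneg : a + b ≠ 0) : (quadruple a b).card = 4 := by
  unfold quadruple
  rw [card_insert_of_notMem, card_insert_of_notMem, card_insert_of_notMem, card_singleton] <;>
    simp only [mem_insert, mem_singleton] <;> grind

variable [NeZero n]

theorem failureSum_le_of_generic (c2 : ∀ u : ZMod n, 2 * u = 0 → u = 0)
    (c3 : ∀ u : ZMod n, 3 * u = 0 → u = 0) {a b : ZMod n} (ha : a ≠ 0) (hb : b ≠ 0) (hab : a ≠ b)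
    (hneg : a + b ≠ 0) (h12 : b ≠ 2 * a) (h21 : a ≠ 2 * b) (h23 : 3 * a ≠ 2 * b)
    (h32 : 2 * a ≠ 3 * b) (h13 : b ≠ 3 * a) (hp : b ≠ -2 * a) (hp' : a ≠ -2 * b)
    {x : ℝ} (hx : 0 ≤ x) (hx1 : x ≤ 1) :
    9 ≤ n ∧ failureSum (circulant n {a, b}) x ≤
      stepFreeSum (b - a) x + (n * x ^ 4 + n * (n - 9) * x ^ 5 + 2 ^ n * x ^ 6) := by
  have hQ := card_quadruple_eq_four ha hb hab hneg
  have a2 : 2 * a ≠ 0 := fun h => ha (c2 _ h)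
  have b2 : 2 * b ≠ 0 := fun h => hb (c2 _ h)
  have d2 : 2 * (a - b) ≠ 0 := fun h => hab (sub_eq_zero.1 (c2 _ h))
  have d3 : 3 * (a - b) ≠ 0 := fun h => hab (sub_eq_zero.1 (c3 _ h))
  -- Five of the six points `q ± (b - a)` next to the quadruple; adding one makes a new failed pair
  -- and violates closure. For steps 2 and 3 these six points coincide down to four, giving 8 in
  -- place of 9.
  refine failureSum_le_of_extensions hQ (B := {a - b, 2 * (b - a), -b, b - 2 * a, a}) ?_ ?_
    (fun F hF hfree hcard => ?_) hx hx1
  · rw [card_insert_of_notMem, card_insert_of_notMem, card_insert_of_notMem, card_insert_of_notMem,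
      card_singleton] <;> simp only [mem_insert, mem_singleton] <;> grind
  · rw [Finset.disjoint_left]
    intro v
    simp only [quadruple, mem_insert, mem_singleton]
    rintro (rfl | rfl | rfl | rfl) <;> grind
  · obtain ⟨y, z, hz, hFz, hclosed⟩ := hF.exists_insert hQ hfree hcard
    refine ⟨y, z, ?_, hFz⟩
    rw [mem_union, not_or]
    refine ⟨hz, fun hzB => ?_⟩
    simp only [mem_insert, mem_singleton] at hzB
    unfold PairClosed at hclosed
    simp only [quadruple, mem_insert, mem_singleton] at hclosed
    rcases hzB with rfl | rfl | rfl | rfl | rfl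
    · have := (hclosed (a - b) (by simp) (by simp)).1
      grind
    · have := (hclosed (b - a) (by simp) (Or.inl (by ring))).1
      grind
    · have := (hclosed (-b) (by simp) (Or.inr (Or.inl (by ring)))).1
      grind
    · have := (hclosed (-a) (by simp) (Or.inl (by ring))).1
      grind
    · have := (hclosed z (by simp) (Or.inr (Or.inr (Or.inr (Or.inr (by ring)))))).2
      grind

theorem failureSum_le_of_progression (c2 : ∀ u : ZMod n, 2 * u = 0 → u = 0)
    (c3 : ∀ u : ZMod n, 3 * u = 0 → u = 0) {a : ZMod n} (a1 : a ≠ 0) (a5 : 5 * a ≠ 0)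
    (a7 : 7 * a ≠ 0) {x : ℝ} (hx : 0 ≤ x) (hx1 : x ≤ 1) :
    9 ≤ n ∧ failureSum (circulant n {a, -2 * a}) x ≤
      stepFreeSum (-2 * a - a) x + (n * x ^ 4 + n * (n - 9) * x ^ 5 + 2 ^ n * x ^ 6) := by
  have a2 : 2 * a ≠ 0 := fun h => a1 (c2 _ h)
  have a3 : 3 * a ≠ 0 := fun h => a1 (c3 _ h)
  have a4 : 4 * a ≠ 0 := fun h => a2 (c2 _ (by linear_combination h))
  have a6 : 6 * a ≠ 0 := fun h => a3 (c2 _ (by linear_combination h))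
  have a8 : 8 * a ≠ 0 := fun h => a4 (c2 _ (by linear_combination h))
  have a9 : 9 * a ≠ 0 := fun h => a3 (c3 _ (by linear_combination h))
  have hQ := card_quadruple_eq_four (a := a) (b := -2 * a) a1 (by grind) (by grind) (by grind)
  refine failureSum_le_of_extensions hQ (B := {3 * a, -6 * a, 2 * a, -5 * a, a}) ?_ ?_
    (fun F hF hfree hcard => ?_) hx hx1
  · rw [card_insert_of_notMem, card_insert_of_notMem, card_insert_of_notMem, card_insert_of_notMem,
      card_singleton] <;> simp only [mem_insert, mem_singleton] <;> grind
  · rw [Finset.disjoint_left]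
    intro v
    simp only [quadruple, mem_insert, mem_singleton]
    rintro (rfl | rfl | rfl | rfl) <;> grind
  · obtain ⟨y, z, hz, hFz, hclosed⟩ := hF.exists_insert hQ hfree hcard
    by_cases hza : z = a
    -- The quadruple is now the progression `-3a, …, 0`. Adding `a` or `-4a` gives five-term
    -- progressions that are translates of each other, so `z = a` need not be counted separately.
    · refine ⟨y + a, -4 * a, ?_, ?_⟩
      · simp only [quadruple, mem_union, mem_insert, mem_singleton]
        grind
      · rw [hFz, hza]
        ext v
        simp only [quadruple, image_insert, image_singleton, mem_insert, mem_singleton]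
        grind
    · refine ⟨y, z, ?_, hFz⟩
      rw [mem_union, not_or]
      refine ⟨hz, fun hzB => ?_⟩
      simp only [mem_insert, mem_singleton] at hzB
      unfold PairClosed at hclosed
      simp only [quadruple, mem_insert, mem_singleton] at hclosed
      rcases hzB with rfl | rfl | rfl | rfl | rfl
      · have := (hclosed (3 * a) (by simp) (Or.inr (Or.inr (Or.inl (by ring))))).1
        grind
      · have := (hclosed (-2 * a - a) (by simp) (Or.inl (by ring))).1
        grind
      · have := (hclosed (2 * a) (by simp) (Or.inr (Or.inl (by ring)))).1
        grind
      · have := (hclosed (-2 * a) (by simp) (Or.inl (by ring))).2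
        grind
      · exact hza rfl

end Generic

/-! ### Reduction to the steps 2 and 3 and the case analysis. -/

section Optimality

variable {n : ℕ}

theorem adj_circulant_mul {a b : ZMod n} (c : ZMod n) {u v : ZMod n}
    (h : (circulant n {a, b}).Adj u v) : (circulant n {c * a, c * b}).Adj (c * u) (c * v) := by
  rcases h with h | h
  · left
    rw [← mul_sub, h]
  · right
    replace h : v - u = b := h
    rw [Set.mem_singleton_iff, ← mul_sub, h]

variable [NeZero n]

theorem failureSum_mul {a b c c' : ZMod n} (hc : c' * c = 1) {x : ℝ} (hx : 0 ≤ x) :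
    failureSum (circulant n {c * a, c * b}) x = failureSum (circulant n {a, b}) x := by
  let e : ZMod n ≃ ZMod n :=
    { toFun := fun u => c * u
      invFun := fun u => c' * u
      left_inv := fun u => by linear_combination u * hc
      right_inv := fun u => by linear_combination u * hc }
  refine le_antisymm (failureSum_le_of_hom e.symm (fun u v h => ?_) hx)
    (failureSum_le_of_hom e (fun u v h => adj_circulant_mul c h) hx)
  have := adj_circulant_mul c' h
  rwa [← mul_assoc, ← mul_assoc, hc, one_mul, one_mul] at this

/-- The relation gives `a = 2(b - a)` and `b = 3(b - a)`, so `b - a` generates and is a unit. -/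
theorem failureSum_eq_two_three {a b : ZMod n} (hgen : AddSubgroup.closure {a, b} = ⊤)
    (h : 3 * a = 2 * b) {x : ℝ} (hx : 0 ≤ x) :
    failureSum (circulant n {a, b}) x = failureSum (circulant n {2, 3}) x := by
  have ha : a = (b - a) * 2 := by linear_combination h
  have hb : b = (b - a) * 3 := by linear_combination h
  obtain ⟨c, hc⟩ := exists_mul_eq_one (closure_pair_eq_zmultiples (c := b - a)
    (AddSubgroup.mem_zmultiples_iff.2 ⟨2, by rw [zsmul_eq_mul]; push_cast; linear_combination -ha⟩)
    (AddSubgroup.mem_zmultiples_iff.2 ⟨3, by rw [zsmul_eq_mul]; push_cast; linear_combination -hb⟩)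
    hgen)
  have := failureSum_mul (a := 2) (b := 3) hc hx
  rwa [← ha, ← hb] at this

theorem failureSum_le_two_three (hn : 5 ≤ n) (hodd : Odd n) (h3 : ¬ 3 ∣ n) {a b : ZMod n}
    (hab : a ≠ b) (hgen : IsGeneratingSet {a, b}) {x : ℝ} (hx : 0 ≤ x) (hx1 : x ≤ 1)
    (hxn : 2 ^ n * x ≤ 1) :
    failureSum (circulant n {a, b}) x ≤ failureSum (circulant n {2, 3}) x := by
  have c2 : ∀ u : ZMod n, 2 * u = 0 → u = 0 := by
    intro u hu
    have h2 := ZMod.coe_mul_inv_eq_one (n := n) 2 hodd.coprime_two_left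
    push_cast at h2
    linear_combination (2⁻¹ : ZMod n) * hu - u * h2
  have c3 : ∀ u : ZMod n, 3 * u = 0 → u = 0 := by
    intro u hu
    have h3 := ZMod.coe_mul_inv_eq_one (n := n) 3
      ((Nat.Prime.coprime_iff_not_dvd Nat.prime_three).2 h3)
    push_cast at h3
    linear_combination (3⁻¹ : ZMod n) * hu - u * h3
  have hfree : ∀ d : ZMod n, stepFreeSum d x ≤ stepFreeSum (1 : ZMod n) x := fun d =>
    stepFreeSum_le_stepFreeSum_one hodd d hx
  have ha : a ≠ 0 := fun h => hgen.1 (by simp [h])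
  have hb : b ≠ 0 := fun h => hgen.1 (by simp [h])
  have hgen' : AddSubgroup.closure {b, a} = ⊤ := by rw [Set.pair_comm]; exact hgen.2
  have hsing := stepFreeSum_add_singletons_le (n := n) (by omega) hodd h3 hx
  by_cases h23 : 3 * a = 2 * b
  · exact (failureSum_eq_two_three hgen.2 h23 hx).le
  by_cases h32 : 2 * a = 3 * b
  · rw [Set.pair_comm]
    exact (failureSum_eq_two_three hgen' h32.symm hx).le
  by_cases h21 : a = 2 * b
  · subst h21
    have := failureSum_le_of_eq_two_mul hgen.2 hx
    linarith [hfree (b - 2 * b)]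
  by_cases h12 : b = 2 * a
  · subst h12
    rw [Set.pair_comm]
    have := failureSum_le_of_eq_two_mul hgen' hx
    linarith [hfree (a - 2 * a)]
  by_cases hneg : a + b = 0
  · obtain rfl : b = -a := by linear_combination hneg
    have a2 : 2 * a ≠ 0 := fun h => ha (c2 _ h)
    have := failureSum_le_of_neg hn ha a2 (fun h => ha (c3 _ h))
      (fun h => a2 (c2 _ (by linear_combination h))) (fun h => h23 (by linear_combination h)) hx hx1
    have h1 : 2 ^ n * x ^ 3 ≤ x ^ 2 := by
      have := mul_le_mul_of_nonneg_right hxn (sq_nonneg x)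
      linarith
    have h2 : 0 ≤ n * x ^ (n - 1) := by positivity
    linarith [hfree (-a - a)]
  suffices hbound : ∃ d : ZMod n, 9 ≤ n ∧ failureSum (circulant n {a, b}) x ≤
      stepFreeSum d x + (n * x ^ 4 + n * (n - 9) * x ^ 5 + 2 ^ n * x ^ 6) by
    obtain ⟨d, hn9, hd⟩ := hbound
    -- The value 9 is excluded by divisibility by 3, and 10 by parity.
    have hn11 : 11 ≤ n := by
      obtain ⟨m, rfl⟩ := hodd
      omega
    have hquad := stepFreeSum_add_quadruples_le (n := n) hn11 hodd h3 hx
    have h1 : 2 ^ n * x ^ 6 ≤ x ^ 5 := by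
      have := mul_le_mul_of_nonneg_right hxn (pow_nonneg hx 5)
      linarith
    have h2 : x ^ 5 ≤ n * x ^ 5 := by
      have : (1 : ℝ) ≤ n := by exact_mod_cast (by omega : 1 ≤ n)
      exact le_mul_of_one_le_left (pow_nonneg hx 5) this
    linarith [hfree d]
  by_cases hp : b = -2 * a
  · subst hp
    exact ⟨_, failureSum_le_of_progression c2 c3 ha (fun h => h21 (by linear_combination h))
      (fun h => h23 (by linear_combination h)) hx hx1⟩
  by_cases hp' : a = -2 * b
  · subst hp'
    rw [Set.pair_comm]
    exact ⟨_, failureSum_le_of_progression c2 c3 hb (fun h => h12 (by linear_combination h))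
      (fun h => h32 (by linear_combination -h)) hx hx1⟩
  -- Here `b - 2a = a` merges two of the five excluded points. Exchanging `a` and `b` repairs this,
  -- because `a = 3b` as well would give `8a = 0`.
  by_cases h13 : b = 3 * a
  · rw [Set.pair_comm]
    refine ⟨_, failureSum_le_of_generic c2 c3 hb ha hab.symm (by rwa [add_comm]) h21 h12
      (fun h => h32 h.symm) (fun h => h23 h.symm) (fun h => ?_) hp' hp hx hx1⟩
    exact ha (c2 _ (c2 _ (c2 _ (by linear_combination -h - 3 * h13))))
  · exact ⟨_, failureSum_le_of_generic c2 c3 ha hb hab hneg h12 h21 h23 h32 h13 hp hp' hx hx1⟩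

end Optimality

end CirculantReliability

/-! ### The main theorem. -/

open CirculantReliability

theorem mainTheorem5 (n : ℕ) [NeZero n] (hn : 1 < n) (hodd : Odd n) (h3 : ¬ 3 ∣ n) :
    CirculantReliability.IsOptimallyGreatestNear (CirculantReliability.twoCirculants n)
      (CirculantReliability.circulant n {1, 2 * (3 : ZMod n)⁻¹}) 1 := by
  have hn5 : 5 ≤ n := by
    obtain ⟨m, rfl⟩ := hodd
    omega
  have h3u : (3 : ZMod n) * 3⁻¹ = 1 := by
    have := ZMod.coe_mul_inv_eq_one (n := n) 3
      ((Nat.Prime.coprime_iff_not_dvd Nat.prime_three).2 h3)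
    exact_mod_cast this
  have c1 : (1 : ZMod n) ≠ 0 := by
    exact_mod_cast natCast_ne_zero_of_lt (n := n) (k := 1) (by omega) (by omega)
  have c2 : (2 : ZMod n) ≠ 0 := by
    exact_mod_cast natCast_ne_zero_of_lt (n := n) (k := 2) (by omega) (by omega)
  have hne : (1 : ZMod n) ≠ 2 * 3⁻¹ := fun h => c1 (by linear_combination 3 * h + 2 * h3u)
  have hgen : IsGeneratingSet ({1, 2 * (3 : ZMod n)⁻¹} : Set (ZMod n)) := by
    constructor
    · rintro (h | h)
      · exact c1 h.symm
      · replace h : (0 : ZMod n) = 2 * 3⁻¹ := h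
        exact c2 (by linear_combination -3 * h - 2 * h3u)
    · rw [eq_top_iff]
      intro v _
      have h1 : (1 : ZMod n) ∈ AddSubgroup.closure ({1, 2 * (3 : ZMod n)⁻¹} : Set (ZMod n)) :=
        AddSubgroup.subset_closure (Set.mem_insert _ _)
      have := AddSubgroup.nsmul_mem _ h1 v.val
      simpa using this
  -- This `ε` gives `2 ^ n * (1 - p) < 1 / 2 < p`, hence `2 ^ n * x ≤ 1` for `x = (1 - p) / p`.
  refine ⟨⟨1, 2 * 3⁻¹, hne, hgen, rfl⟩, 1 / 2 ^ (n + 1), by positivity, ?_⟩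
  rintro H ⟨a, b, hab, hH, rfl⟩ p ⟨⟨hp0, hp1⟩, hp, -⟩
  have hpow : (0 : ℝ) < 2 ^ n := by positivity
  have hp' : 2 ^ n * (1 - p) < 1 / 2 := by
    have h : 1 - p < 1 / 2 ^ (n + 1) := by linarith
    have := mul_lt_mul_of_pos_left h hpow
    rwa [show (2 : ℝ) ^ n * (1 / 2 ^ (n + 1)) = 1 / 2 by rw [pow_succ]; field_simp] at this
  have hone : (1 : ℝ) ≤ 2 ^ n := one_le_pow₀ (by norm_num)
  have hhalf : 1 / 2 < p := by nlinarith
  have hppos : 0 < p := by linarith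
  have hx : 0 ≤ (1 - p) / p := div_nonneg (by linarith) hp0
  have hxn : 2 ^ n * ((1 - p) / p) ≤ 1 := by
    rw [← mul_div_assoc, div_le_one hppos]
    linarith
  have hx1 : (1 - p) / p ≤ 1 := by
    rw [div_le_one hppos]
    linarith
  rw [reliability_eq_failureSum _ hppos.ne', reliability_eq_failureSum _ hppos.ne']
  refine mul_le_mul_of_nonneg_left ?_ (pow_nonneg hp0 _)
  have hG : failureSum (circulant n {1, 2 * (3 : ZMod n)⁻¹}) ((1 - p) / p) =
      failureSum (circulant n {2, 3}) ((1 - p) / p) := by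
    rw [Set.pair_comm]
    refine failureSum_eq_two_three ?_ (by linear_combination 2 * h3u) hx
    rw [Set.pair_comm]
    exact hgen.2
  rw [hG]
  exact failureSum_le_two_three hn5 hodd h3 hab hH hx hx1 hxn
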